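/- Let $(\mathcal A,\phi)$ be a scalar probability space: $\mathcal A$ is a unital $\star$-algebra over $\mathbb C$ and $\phi:\mathcal A\to\mathbb C$ is a faithful tracial state. Let $a\in\mathcal A$, and write $a^{1}:=a$, $a^{-1}:=a^{\star}$. The element $a$ is called $R$-diagonal if $\phi(x_1x_2\cdots x_n)=0$ for all $n\ge 1$, all $i_1,\dots,i_{n+1}\in\{1,2\}$ and all $x_1\in P_{i_1i_2}$, $x_2\in P_{i_2i_3},\dots,x_n\in P_{i_ni_{n+1}}$, where $$P_{11}=\operatorname{span}\{a^\star,\,a^\star a a^\star,\,a^\star a a^\star a a^\star,\dots\},\qquad P_{12}=\{x\in\operatorname{span}\{1,\,a^\star a,\,a^\star a a^\star a,\dots\}:\phi(x)=0\},$$ $$P_{21}=\{x\in\operatorname{span}\{1,\,aa^\star,\,aa^\star aa^\star,\dots\}:\phi(x)=0\},\qquad P_{22}=\operatorname{span}\{a,\,aa^\star a,\,aa^\star aa^\star a,\dots\}.$$ Two elements $b,c\in\mathcal A$ have the same distribution if $\phi(b^{s_1}\cdots b^{s_n})=\phi(c^{s_1}\cdots c^{s_n})$ for all $n\ge1$ and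 $s_1,\dots,s_n\in\{-1,1\}$. A nonempty sequence $(s_1,\dots,s_n)$ with $s_j\in\{-1,1\}$ is balanced if $s_1+\cdots+s_n=0$ and $s_1+\cdots+s_k\le 0$ for all $1\le k\le n-1$. Put $$\mathcal K_a=\operatorname{span}\{a^{s_1}a^{s_2}\cdots a^{s_n}:\ (s_1,\dots,s_n)\text{ is balanced}\}.$$ Two subsets $X_1,X_2\subseteq\mathcal A$ are free if $\phi(x_1\cdots x_n)=0$ whenever $n\ge1$, $j_1,\dots,j_n\in\{1,2\}$ with $j_k\ne j_{k+1}$ for $1\le k<n$, each $x_k$ belongs to the unital subalgebra of $\mathcal A$ generated by $X_{j_k}$, and $\phi(x_1)=\cdots=\phi(x_n)=0$. **Theorem.** The element $a\in(\mathcal A,\phi)$ is $R$-diagonal if and only if the following two conditions hold: 1. for every $z\in\mathbb C$ with $|z|=1$, the elements $a$ and $za$ have the same distribution; 2. $\{aa^\star\}$ and $\mathcal K_a$ are free. -/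

import Mathlib

namespace FreeProb

/-- `φ` is a faithful tracial state on the unital `⋆`-algebra `A`, i.e. `(A, φ)` is a scalar
(noncommutative) probability space. -/
structure IsFaithfulTracialState {A : Type*} [Ring A] [StarRing A] [Algebra ℂ A]
    (φ : A →ₗ[ℂ] ℂ) : Prop where
  map_one : φ 1 = 1
  nonneg_re : ∀ x : A, 0 ≤ (φ (star x * x)).re
  im_eq_zero : ∀ x : A, (φ (star x * x)).im = 0
  faithful : ∀ x : A, φ (star x * x) = 0 → x = 0
  tracial : ∀ x y : A, φ (x * y) = φ (y * x)

/-- The letter `a ^ s` for a sign `s`: `a ^ 1 := a` and `a ^ (-1) := a⋆`. -/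
def letter {A : Type*} [Star A] (a : A) (s : ℤˣ) : A :=
  if s = 1 then a else star a

/-- The word `a ^ s₁ * a ^ s₂ * ⋯ * a ^ sₙ`. -/
def word {A : Type*} [Ring A] [StarRing A] (a : A) (s : List ℤˣ) : A :=
  (s.map (letter a)).prod

/-- `a` in `(A, φ)` and `b` in `(B, ψ)` have the same (`⋆`-)distribution. -/
def SameDistribution {A B : Type*} [Ring A] [StarRing A] [Algebra ℂ A]
    [Ring B] [StarRing B] [Algebra ℂ B]
    (φ : A →ₗ[ℂ] ℂ) (a : A) (ψ : B →ₗ[ℂ] ℂ) (b : B) : Prop :=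
  ∀ s : List ℤˣ, s ≠ [] → φ (word a s) = ψ (word b s)

/-- A family `(X i)` of subsets of `A` is free with respect to `φ`: every nonempty product of
centered elements of the generated unital algebras `Alg(X i ∪ ℂ)`, in which neighbouring
factors belong to different indices, is centered. A product is given by the list of its
factors together with their indices. -/
def IsFree {A : Type*} [Ring A] [Algebra ℂ A] (φ : A →ₗ[ℂ] ℂ) {ι : Type*}
    (X : ι → Set A) : Prop :=
  ∀ l : List (ι × A), l ≠ [] →
    (l.map Prod.fst).IsChain (fun i j => i ≠ j) →
    (∀ p ∈ l, p.2 ∈ Algebra.adjoin ℂ (X p.1)) →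
    (∀ p ∈ l, φ p.2 = 0) →
    φ (l.map Prod.snd).prod = 0

/-- A nonempty sequence of signs is balanced if its sum is `0` and all its partial sums
are `≤ 0`. -/
def IsBalanced (s : List ℤˣ) : Prop :=
  s ≠ [] ∧ (s.map (fun t : ℤˣ => (t : ℤ))).sum = 0 ∧
    ∀ k < s.length, ((s.take k).map (fun t : ℤˣ => (t : ℤ))).sum ≤ 0

/-- The algebra `K_a`, the span of all words in `a`, `a⋆` with balanced sign sequence. -/
def balancedSpan {A : Type*} [Ring A] [StarRing A] [Algebra ℂ A] (a : A) : Submodule ℂ A :=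
  Submodule.span ℂ {x | ∃ s : List ℤˣ, IsBalanced s ∧ x = word a s}

/-- The spaces `P₁₁, P₁₂, P₂₁, P₂₂` spanned by alternating words in `a` and `a⋆`; the index
`0` stands for `1` and the index `1` for `2`.
`P₁₁ = span {a⋆, a⋆aa⋆, …}`, `P₁₂ = {x ∈ span {1, a⋆a, a⋆aa⋆a, …} | φ x = 0}`,
`P₂₁ = {x ∈ span {1, aa⋆, aa⋆aa⋆, …} | φ x = 0}`, `P₂₂ = span {a, aa⋆a, …}`. -/
def altSpace {A : Type*} [Ring A] [StarRing A] [Algebra ℂ A] (φ : A →ₗ[ℂ] ℂ) (a : A) :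
    Fin 2 → Fin 2 → Submodule ℂ A
  | 0, 0 => Submodule.span ℂ (Set.range fun k : ℕ => star a * (a * star a) ^ k)
  | 0, 1 => Submodule.span ℂ (Set.range fun k : ℕ => (star a * a) ^ k) ⊓ LinearMap.ker φ
  | 1, 0 => Submodule.span ℂ (Set.range fun k : ℕ => (a * star a) ^ k) ⊓ LinearMap.ker φ
  | 1, 1 => Submodule.span ℂ (Set.range fun k : ℕ => a * (star a * a) ^ k)

/-- `a` is (scalar) `R`-diagonal in `(A, φ)`: for all `n ≥ 1` and all indices
`i₁, …, iₙ₊₁`, one has `φ (x₁ ⋯ xₙ) = 0` whenever `xₖ ∈ P_{iₖ iₖ₊₁}` for all `k`. -/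
def IsRDiagonal {A : Type*} [Ring A] [StarRing A] [Algebra ℂ A] (φ : A →ₗ[ℂ] ℂ) (a : A) :
    Prop :=
  ∀ n : ℕ, 1 ≤ n → ∀ (i : Fin (n + 1) → Fin 2) (x : Fin n → A),
    (∀ k : Fin n, x k ∈ altSpace φ a (i k.castSucc) (i k.succ)) →
    φ (List.ofFn x).prod = 0

end FreeProb

/-!
The spaces `P₁₁, P₁₂, P₂₁, P₂₂` are the edges of a graph on the vertices `1, 2`, written `0, 1`
here, and `R`-diagonality says that `φ` kills every product along a nonempty path
(`isRDiagonal_iff_altPath`). Such a product has a degree, the number of letters `a` minus the number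
of letters `a⋆`, and its factors sit at heights, the degrees of its prefixes. The basic computation
is `altSpace_mul`: two factors whose neighbouring letters differ merge into one factor, up to a
scalar. The distribution of `a` is rotation invariant if and only if `φ` kills all words of nonzero
degree (`sameDistribution_smul_iff`).

Suppose that `a` is `R`-diagonal. Appending letters one at a time, every word becomes a combination
of path products of the same degree and with the same bound on the heights
(`wordSpan_le_span_altPath`). Hence words of nonzero degree are killed. A balanced word becomes a
scalar plus path products from `1` to `2`, because a nonempty path that returns to height `0`
without any letter exceeding that height has to start with `a⋆` and end with `a`
(`AltPath.endpoints_of_letter`). So centered elements of `Alg(K_a)` are combinations of paths from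
`1` to `2`, those of `Alg(aa⋆)` are in `P₂₁`, and alternating products of both are combinations of
longer paths, which `φ` kills.

Conversely, assume both conditions and argue by induction on the number of factors of a path
(`AltPath.map_eq_zero`). If the end points differ, traciality allows the last factor to be merged
with the first one, which leaves shorter paths. A closed path of nonzero degree is killed by rotation
invariance. A closed path of degree `0` is rotated so that it starts at a point of maximal height
(`AltPath.exists_split_top`); then its factors from `P₂₁` at the top height separate elements of
`Alg(K_a)`, which are centered by induction (`AltPath.exists_parse`), and freeness applies.
-/

namespace FreeProb

section

variable {A : Type*} [Ring A] [StarRing A] [Algebra ℂ A] {φ : A →ₗ[ℂ] ℂ} {a : A}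

/-! ### Alternating words -/

/-- The alternating words in `a⋆` and `a`. The first index records the first letter and the second
index the last letter, `0` standing for `a⋆` and `1` for `a`; the empty word counts as a word of
both mixed types. -/
def altGen (a : A) : Fin 2 → Fin 2 → ℕ → A
  | 0, 0 => fun k => star a * (a * star a) ^ k
  | 0, 1 => fun k => (star a * a) ^ k
  | 1, 0 => fun k => (a * star a) ^ k
  | 1, 1 => fun k => a * (star a * a) ^ k

lemma mem_altSpace {j k : Fin 2} {y : A} :
    y ∈ altSpace φ a j k ↔
      y ∈ Submodule.span ℂ (Set.range (altGen a j k)) ∧ (j ≠ k → φ y = 0) := by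
  fin_cases j <;> fin_cases k <;> simp [altSpace, altGen]

omit [Algebra ℂ A] in
lemma altGen_mul {l j i k : Fin 2} (hij : j ≠ i) (m n : ℕ) :
    ∃ r, altGen a l j m * altGen a i k n = altGen a l k r := by
  have h₁ (m n : ℕ) : (a * star a) ^ m * (a * (star a * a) ^ n) = a * (star a * a) ^ (m + n) := by
    rw [← mul_assoc, mul_pow_mul, mul_assoc, pow_add]
  have h₂ (m n : ℕ) :
      (star a * a) ^ m * (star a * (a * star a) ^ n) = star a * (a * star a) ^ (m + n) := by
    rw [← mul_assoc, mul_pow_mul, mul_assoc, pow_add]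
  fin_cases j <;> fin_cases i <;> first | exact absurd rfl hij | skip
  · fin_cases l <;> fin_cases k <;> dsimp only [altGen]
    · exact ⟨m + n, by rw [pow_add, mul_assoc]⟩
    · exact ⟨m + n + 1, by rw [mul_assoc, h₁, ← mul_assoc, ← pow_succ']⟩
    · exact ⟨m + n, by rw [pow_add]⟩
    · exact ⟨m + n, h₁ m n⟩
  · fin_cases l <;> fin_cases k <;> dsimp only [altGen]
    · exact ⟨m + n, h₂ m n⟩
    · exact ⟨m + n, by rw [pow_add]⟩
    · exact ⟨m + n + 1, by rw [mul_assoc, h₂, ← mul_assoc, ← pow_succ']⟩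
    · exact ⟨m + n, by rw [pow_add, mul_assoc]⟩

/-- Merging two alternating factors whose neighbouring letters differ: the product is again
alternating, hence lies in the corresponding space `P` up to the scalar that centers it. -/
lemma altSpace_mul (h1 : φ 1 = 1) {l j i k : Fin 2} (hij : j ≠ i) {w y : A}
    (hw : w ∈ altSpace φ a l j) (hy : y ∈ altSpace φ a i k) :
    ∃ u ∈ altSpace φ a l k, ∃ c : ℂ, w * y = u + c • 1 ∧ (l = k → c = 0) := by
  have hmem : w * y ∈ Submodule.span ℂ (Set.range (altGen a l k)) := by
    have := Submodule.mul_mem_mul (mem_altSpace.1 hw).1 (mem_altSpace.1 hy).1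
    rw [Submodule.span_mul_span] at this
    refine Submodule.span_mono ?_ this
    rintro _ ⟨_, ⟨m, rfl⟩, _, ⟨n, rfl⟩, rfl⟩
    obtain ⟨r, hr⟩ := altGen_mul (a := a) (l := l) (k := k) hij m n
    exact ⟨r, hr.symm⟩
  by_cases hlk : l = k
  · exact ⟨w * y, mem_altSpace.2 ⟨hmem, fun h => absurd hlk h⟩, 0, by simp⟩
  · have hone : (1 : A) ∈ Submodule.span ℂ (Set.range (altGen a l k)) := by
      refine Submodule.subset_span ⟨0, ?_⟩
      fin_cases l <;> fin_cases k <;> simp_all [altGen]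
    refine ⟨w * y - φ (w * y) • 1, mem_altSpace.2 ⟨Submodule.sub_mem _ hmem
      (Submodule.smul_mem _ _ hone), fun _ => by simp [h1]⟩, φ (w * y), by simp,
      fun h => absurd h hlk⟩

/-- The degree (number of letters `a` minus number of letters `a⋆`) of an element of
`altSpace φ a j k`: it is `-1` for `P₁₁`, `1` for `P₂₂` and `0` otherwise. -/
def stepDeg (j k : Fin 2) : ℤ := ((j : ℕ) : ℤ) + ((k : ℕ) : ℤ) - 1

lemma stepDeg_add {l j i : Fin 2} (h : j ≠ i) :
    stepDeg l j + stepDeg i i = stepDeg l i := by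
  unfold stepDeg; omega

lemma stepDeg_add_self {l j i : Fin 2} (h : j ≠ i) (hl : l ≠ i) :
    stepDeg l j + stepDeg i i = 0 := by
  unfold stepDeg; omega

lemma letter_mem_altSpace (φ : A →ₗ[ℂ] ℂ) (a : A) (t : ℤˣ) :
    ∃ i, letter a t ∈ altSpace φ a i i ∧ (t : ℤ) = stepDeg i i := by
  rcases Int.units_eq_one_or t with rfl | rfl
  · exact ⟨1, mem_altSpace.2 ⟨Submodule.subset_span ⟨0, by simp [altGen, letter]⟩, by simp⟩,
      by simp [stepDeg]⟩
  · exact ⟨0, mem_altSpace.2 ⟨Submodule.subset_span ⟨0, by simp [altGen, letter]⟩, by simp⟩,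
      by simp [stepDeg]⟩

/-! ### Paths of alternating factors -/

/-- `AltPath φ a C n h i j x`: the element `x` is a product of `n` factors taken from the spaces
`altSpace φ a` along a path from `i` to `j`, of total degree `h`. A factor of type `(j, k)` may be
used at height `h` (the degree of the product of the previous factors) only if `C h j k`. -/
inductive AltPath (φ : A →ₗ[ℂ] ℂ) (a : A) (C : ℤ → Fin 2 → Fin 2 → Prop) :
    ℕ → ℤ → Fin 2 → Fin 2 → A → Prop
  | nil (i : Fin 2) : AltPath φ a C 0 0 i i 1
  | snoc {n : ℕ} {h : ℤ} {i j k : Fin 2} {x y : A} : AltPath φ a C n h i j x →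
      y ∈ altSpace φ a j k → C h j k → AltPath φ a C (n + 1) (h + stepDeg j k) i k (x * y)

/-- No constraint on the heights. -/
def freeStep : ℤ → Fin 2 → Fin 2 → Prop := fun _ _ _ => True

/-- The heights between the factors stay nonpositive, while single letters of a factor `aa⋆ ⋯`
may exceed height `0`. -/
def topStep : ℤ → Fin 2 → Fin 2 → Prop := fun h j k => h + stepDeg j k ≤ 0

/-- All the letters of the factor stay at heights in `S`, for a lower set `S`: the maximal height
reached inside an alternating word is its starting height, plus one if its first letter
is `a`. -/
def letterStep (S : Set ℤ) : ℤ → Fin 2 → Fin 2 → Prop := fun h j _ => h + ((j : ℕ) : ℤ) ∈ S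

variable {C D : ℤ → Fin 2 → Fin 2 → Prop}

lemma AltPath.mono (hCD : ∀ h j k, C h j k → D h j k) {n h i j x}
    (p : AltPath φ a C n h i j x) : AltPath φ a D n h i j x := by
  induction p with
  | nil i => exact .nil i
  | snoc _ hy hc ih => exact ih.snoc hy (hCD _ _ _ hc)

lemma AltPath.free {n h i j x} (p : AltPath φ a C n h i j x) :
    AltPath φ a freeStep n h i j x :=
  p.mono fun _ _ _ _ => trivial

lemma AltPath.single {i j : Fin 2} {y : A} (hy : y ∈ altSpace φ a i j) (hc : C 0 i j) :
    AltPath φ a C 1 (stepDeg i j) i j y := by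
  simpa using (AltPath.nil i).snoc hy hc

/-- Concatenation of paths. The second constraint only has to imply the first one after a shift
by the degree of the first path. -/
lemma AltPath.mul {n n' h h' i j k x x'} (p : AltPath φ a C n h i j x)
    (q : AltPath φ a D n' h' j k x') (hDC : ∀ h' j k, D h' j k → C (h + h') j k) :
    AltPath φ a C (n + n') (h + h') i k (x * x') := by
  induction q with
  | nil => simpa using p
  | snoc _ hy hc ih =>
    rw [← mul_assoc, ← add_assoc, ← add_assoc]
    exact (ih p).snoc hy (hDC _ _ _ hc)

lemma AltPath.mul_free {n n' h h' i j k x x'} (p : AltPath φ a freeStep n h i j x)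
    (q : AltPath φ a freeStep n' h' j k x') :
    AltPath φ a freeStep (n + n') (h + h') i k (x * x') :=
  p.mul q fun _ _ _ _ => trivial

/-- The first factor of a nonempty path can be split off. -/
lemma AltPath.exists_cons {n h i j x} (p : AltPath φ a freeStep (n + 1) h i j x) :
    ∃ k y h' x', y ∈ altSpace φ a i k ∧ AltPath φ a freeStep n h' k j x' ∧ x = y * x' := by
  induction n generalizing h j x with
  | zero =>
    cases p with
    | snoc p hy _ =>
      cases p
      exact ⟨_, _, _, _, hy, .nil _, by simp⟩
  | succ n ih =>
    cases p with
    | snoc p hy _ =>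
      obtain ⟨k, y, h', x', hy', q, rfl⟩ := ih p
      exact ⟨k, y, _, _, hy', q.snoc hy trivial, mul_assoc _ _ _⟩

lemma AltPath.zero {h i j x} (p : AltPath φ a C 0 h i j x) : i = j ∧ x = 1 := by
  cases p; exact ⟨rfl, rfl⟩

lemma AltPath.height_nonpos_of_top {n h i j x} (p : AltPath φ a topStep n h i j x) : h ≤ 0 := by
  cases p with
  | nil => rfl
  | snoc _ _ hc => exact hc

lemma topStep_of_letterStep {h : ℤ} {j k : Fin 2} (hc : letterStep (Set.Iic 0) h j k) :
    topStep h j k := by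
  simp only [letterStep, Set.mem_Iic, topStep, stepDeg] at *; omega

lemma AltPath.height_nonpos_of_letter {n h i j x}
    (p : AltPath φ a (letterStep (Set.Iic 0)) n h i j x) : h ≤ 0 :=
  (p.mono fun _ _ _ => topStep_of_letterStep).height_nonpos_of_top

/-- A nonempty path of degree `0` all of whose letters stay at nonpositive height starts with
`a⋆` and ends with `a`. -/
lemma AltPath.endpoints_of_letter {n h i j x}
    (p : AltPath φ a (letterStep (Set.Iic 0)) (n + 1) h i j x) :
    i = 0 ∧ (h = 0 → j = 1) := by
  induction n generalizing h j x with
  | zero =>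
    cases p with
    | snoc p hy hc =>
      cases p
      simp only [letterStep, Set.mem_Iic, stepDeg] at *
      omega
  | succ n ih =>
    cases p with
    | snoc p hy hc =>
      have h₀ := p.height_nonpos_of_letter
      have h₁ := ih p
      simp only [letterStep, Set.mem_Iic, stepDeg] at *
      exact ⟨h₁.1, by omega⟩

/-- `R`-diagonality says that `φ` vanishes on nonempty paths. -/
lemma isRDiagonal_iff_altPath :
    IsRDiagonal φ a ↔ ∀ n h i j x, AltPath φ a freeStep (n + 1) h i j x → φ x = 0 := by
  constructor
  · intro H n h i j x p
    suffices key : ∀ {n h i j x}, AltPath φ a freeStep n h i j x →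
        ∃ (v : Fin (n + 1) → Fin 2) (f : Fin n → A),
          (∀ k : Fin n, f k ∈ altSpace φ a (v k.castSucc) (v k.succ)) ∧
          v (Fin.last n) = j ∧ x = (List.ofFn f).prod by
      obtain ⟨v, f, hf, -, rfl⟩ := key p
      exact H (n + 1) (by omega) v f hf
    intro n h i j x p
    induction p with
    | nil i => exact ⟨fun _ => i, Fin.elim0, fun k => k.elim0, rfl, by simp⟩
    | @snoc n h i j k x y p hy _ ih =>
      obtain ⟨v, f, hf, rfl, rfl⟩ := ih
      refine ⟨Fin.snoc v k, Fin.snoc f y, fun m => ?_, by simp, ?_⟩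
      · refine Fin.lastCases ?_ (fun m => ?_) m
        · rw [Fin.succ_last, Fin.snoc_last, Fin.snoc_castSucc, Fin.snoc_last]
          exact hy
        · rw [Fin.succ_castSucc, Fin.snoc_castSucc, Fin.snoc_castSucc, Fin.snoc_castSucc]
          exact hf m
      · simp only [List.ofFn_succ', Fin.snoc_castSucc, Fin.snoc_last, List.concat_eq_append,
          List.prod_append, List.prod_singleton]
  · intro H n hn v f hf
    suffices key : ∀ n (v : Fin (n + 1) → Fin 2) (f : Fin n → A),
        (∀ k : Fin n, f k ∈ altSpace φ a (v k.castSucc) (v k.succ)) →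
        ∃ h, AltPath φ a freeStep n h (v 0) (v (Fin.last n)) (List.ofFn f).prod by
      obtain ⟨m, rfl⟩ := Nat.exists_eq_add_of_le' hn
      obtain ⟨h, p⟩ := key (m + 1) v f hf
      exact H _ _ _ _ _ p
    clear H hn hf f v n
    intro n
    induction n with
    | zero => intro v f _; exact ⟨0, by simpa using AltPath.nil (v 0)⟩
    | succ n ih =>
      intro v f hf
      obtain ⟨h, p⟩ := ih (fun k => v k.castSucc) (fun k => f k.castSucc)
        fun k => hf k.castSucc
      have := p.snoc (hf (Fin.last n)) trivial
      refine ⟨h + stepDeg (v (Fin.last n).castSucc) (v (Fin.last n).succ), ?_⟩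
      rw [List.ofFn_succ', List.concat_eq_append, List.prod_append, List.prod_singleton]
      exact this

/-! ### Words with constrained heights -/

/-- The degree of the word with exponents `s`. -/
def signSum (s : List ℤˣ) : ℤ := (s.map (fun t : ℤˣ => (t : ℤ))).sum

/-- The span of the words of degree `h` all of whose prefixes have degree in `S`. -/
def wordSpan (a : A) (S : Set ℤ) (h : ℤ) : Submodule ℂ A :=
  Submodule.span ℂ {x | ∃ s : List ℤˣ, signSum s = h ∧ (∀ k, signSum (s.take k) ∈ S) ∧
    x = word a s}

lemma signSum_append (s t : List ℤˣ) : signSum (s ++ t) = signSum s + signSum t := by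
  simp [signSum]

omit [Algebra ℂ A] in
lemma word_append (s t : List ℤˣ) : word a (s ++ t) = word a s * word a t := by
  simp [word]

lemma one_mem_wordSpan {S : Set ℤ} (h0 : (0 : ℤ) ∈ S) : (1 : A) ∈ wordSpan a S 0 :=
  Submodule.subset_span ⟨[], by simp [signSum], by simpa [signSum] using h0, by simp [word]⟩

lemma letter_mem_wordSpan {S : Set ℤ} (h0 : (0 : ℤ) ∈ S) (t : ℤˣ) (ht : (t : ℤ) ∈ S) :
    letter a t ∈ wordSpan a S t := by
  refine Submodule.subset_span ⟨[t], by simp [signSum], fun k => ?_, by simp [word]⟩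
  cases k
  · simpa [signSum] using h0
  · simpa [signSum] using ht

lemma mul_mem_wordSpan {S T U : Set ℤ} {h h' : ℤ} {x y : A} (hx : x ∈ wordSpan a S h)
    (hy : y ∈ wordSpan a T h') (hS : S ⊆ U) (hT : ∀ t ∈ T, h + t ∈ U) :
    x * y ∈ wordSpan a U (h + h') := by
  have := Submodule.mul_mem_mul hx hy
  rw [wordSpan, wordSpan, Submodule.span_mul_span] at this
  refine Submodule.span_mono ?_ this
  rintro _ ⟨_, ⟨s, rfl, hs, rfl⟩, _, ⟨t, rfl, ht, rfl⟩, rfl⟩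
  refine ⟨s ++ t, signSum_append _ _, fun k => ?_, (word_append _ _).symm⟩
  rw [List.take_append, signSum_append]
  rcases le_total k s.length with hk | hk
  · simpa [Nat.sub_eq_zero_of_le hk, signSum] using hS (hs k)
  · rw [List.take_of_length_le hk]
    exact hT _ (ht _)

lemma altSpace_le_wordSpan (j k : Fin 2) :
    altSpace φ a j k ≤ wordSpan a (Set.Iic ((j : ℕ) : ℤ)) (stepDeg j k) := by
  have hl : a ∈ wordSpan a (Set.Iic 1) 1 := by
    simpa [letter] using letter_mem_wordSpan (a := a) (S := Set.Iic 1) (by simp) 1 (by simp)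
  have hs : star a ∈ wordSpan a (Set.Iic 0) (-1) := by
    simpa [letter] using letter_mem_wordSpan (a := a) (S := Set.Iic 0) (by simp) (-1) (by simp)
  have mul_deg_zero {S T : Set ℤ} {h : ℤ} {x y : A} (hx : x ∈ wordSpan a S h)
      (hy : y ∈ wordSpan a T 0) (hT : ∀ t ∈ T, h + t ∈ S) : x * y ∈ wordSpan a S h := by
    simpa using mul_mem_wordSpan hx hy le_rfl hT
  have h₁ (m : ℕ) : (star a * a) ^ m ∈ wordSpan a (Set.Iic 0) 0 := by
    induction m with
    | zero => simpa using one_mem_wordSpan (by simp)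
    | succ m ih =>
      rw [pow_succ]
      exact mul_deg_zero ih (by simpa using mul_mem_wordSpan (U := Set.Iic 0) hs hl le_rfl (by simp))
        (by simp)
  have h₂ (m : ℕ) : (a * star a) ^ m ∈ wordSpan a (Set.Iic 1) 0 := by
    induction m with
    | zero => simpa using one_mem_wordSpan (by simp)
    | succ m ih =>
      rw [pow_succ]
      exact mul_deg_zero ih (by simpa using mul_mem_wordSpan (U := Set.Iic 1) hl hs le_rfl (by simp))
        (by simp)
  intro y hy
  refine (Submodule.span_le.2 ?_) (mem_altSpace.1 hy).1
  rintro _ ⟨m, rfl⟩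
  fin_cases j <;> fin_cases k
  · simpa [stepDeg, altGen] using mul_deg_zero hs (h₂ m) (by simp)
  · simpa [stepDeg, altGen] using h₁ m
  · simpa [stepDeg, altGen] using h₂ m
  · simpa [stepDeg, altGen] using mul_deg_zero hl (h₁ m) (by simp)

lemma AltPath.mem_wordSpan {S : Set ℤ} (hS : IsLowerSet S) (h0 : (0 : ℤ) ∈ S) {n h i j x}
    (p : AltPath φ a (letterStep S) n h i j x) : x ∈ wordSpan a S h := by
  induction p with
  | nil => exact one_mem_wordSpan h0
  | snoc _ hy hc ih =>
    refine mul_mem_wordSpan ih (altSpace_le_wordSpan _ _ hy) le_rfl fun t ht => hS ?_ hc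
    simpa using ht

/-- Every word is a combination of products along paths which respect the degree and the bound on
the heights. Letters are appended one at a time; a letter that continues the last alternating
block is merged into the last factor. -/
lemma wordSpan_le_span_altPath (h1 : φ 1 = 1) {S : Set ℤ} (h : ℤ) :
    wordSpan a S h ≤
      Submodule.span ℂ {x | ∃ n i j, AltPath φ a (letterStep S) n h i j x} := by
  refine Submodule.span_le.2 ?_
  rintro _ ⟨s, rfl, hs, rfl⟩
  induction s using List.reverseRecOn with
  | nil => exact Submodule.subset_span ⟨0, 0, 0, by simpa [word, signSum] using AltPath.nil 0⟩
  | append_singleton s t ih =>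
    have hs' (k : ℕ) : signSum (s.take k) ∈ S := by
      rcases le_total k s.length with hk | hk
      · simpa [List.take_append, Nat.sub_eq_zero_of_le hk] using hs k
      · simpa [List.take_of_length_le hk, List.take_append] using hs s.length
    have hsum : signSum s ∈ S := by simpa using hs' s.length
    have hsum' : signSum s + t ∈ S := by
      simpa [List.take_of_length_le, signSum] using hs (s ++ [t]).length
    obtain ⟨i, hti, hdeg⟩ := letter_mem_altSpace φ a t
    have hsumt : signSum (s ++ [t]) = signSum s + stepDeg i i := by
      rw [signSum_append, ← hdeg]; simp [signSum]
    have hstep : signSum s + ((i : ℕ) : ℤ) ∈ S := by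
      rw [hdeg] at hsum'
      fin_cases i
      · simpa using hsum
      · simpa [stepDeg] using hsum'
    rw [word_append, hsumt]
    specialize ih hs'
    have hword : word a [t] = letter a t := by simp [word]
    rw [hword]
    clear hs hs' hsum hsum' hsumt hdeg
    generalize signSum s = h at *
    generalize word a s = x at *
    generalize letter a t = y at *
    rw [SetLike.mem_coe] at ih ⊢
    refine Submodule.span_induction (p := fun x _ => x * y ∈ _) ?_ (by simp)
      (fun u v _ _ hu hv => by rw [add_mul]; exact add_mem hu hv)
      (fun c u _ hu => by rw [smul_mul_assoc]; exact Submodule.smul_mem _ c hu) ih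
    rintro x ⟨n, i₀, j, p⟩
    by_cases hji : j = i
    · subst hji
      exact Submodule.subset_span ⟨_, _, _, p.snoc hti hstep⟩
    cases p with
    | nil =>
      exact Submodule.subset_span ⟨1, i, i, by simpa using AltPath.single hti hstep⟩
    | @snoc n h' _ l _ x w p hw hc =>
      obtain ⟨u, hu, c, hwy, hlc⟩ := altSpace_mul h1 hji hw hti
      rw [mul_assoc, hwy, mul_add, add_assoc, stepDeg_add hji]
      refine add_mem (Submodule.subset_span ⟨_, _, _, p.snoc hu hc⟩) ?_
      rw [mul_smul_comm, mul_one]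
      by_cases hl : l = i
      · simp [hlc hl]
      · refine Submodule.smul_mem _ _ (Submodule.subset_span ⟨n, i₀, l, ?_⟩)
        rw [← stepDeg_add hji, stepDeg_add_self hji hl, add_zero]
        exact p

lemma adjoin_balancedSpan_eq_wordSpan :
    Subalgebra.toSubmodule (Algebra.adjoin ℂ (balancedSpan a : Set A)) =
      wordSpan a (Set.Iic 0) 0 := by
  apply le_antisymm
  · rw [balancedSpan, Algebra.adjoin_span, Algebra.adjoin_eq_span]
    refine Submodule.span_le.2 fun x hx => ?_
    induction hx using Submonoid.closure_induction with
    | mem x hx =>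
      obtain ⟨s, ⟨-, hsum, hs⟩, rfl⟩ := hx
      refine Submodule.subset_span ⟨s, hsum, fun k => ?_, rfl⟩
      rcases lt_or_ge k s.length with hk | hk
      · exact hs k hk
      · rw [List.take_of_length_le hk]
        exact hsum.le
    | one => exact one_mem_wordSpan (by simp)
    | mul x y _ _ hx hy =>
      exact mul_mem_wordSpan (h := 0) (h' := 0) hx hy le_rfl (by simp)
  · refine Submodule.span_le.2 ?_
    rintro _ ⟨s, hsum, hs, rfl⟩
    by_cases hnil : s = []
    · subst hnil
      simp [word]
    · exact Algebra.subset_adjoin (Submodule.subset_span ⟨s, ⟨hnil, hsum, fun k _ => hs k⟩, rfl⟩)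

lemma AltPath.mem_adjoin_balancedSpan {n i j x}
    (p : AltPath φ a (letterStep (Set.Iic 0)) n 0 i j x) :
    x ∈ Algebra.adjoin ℂ (balancedSpan a : Set A) := by
  rw [← Subalgebra.mem_toSubmodule, adjoin_balancedSpan_eq_wordSpan]
  exact p.mem_wordSpan (isLowerSet_Iic 0) (by simp)

/-! ### Rotation invariance of the distribution -/

lemma word_smul [StarModule ℂ A] {z : ℂ} (hz : ‖z‖ = 1) (s : List ℤˣ) :
    word (z • a) s = z ^ signSum s • word a s := by
  have hz0 : z ≠ 0 := by rintro rfl; simp at hz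
  induction s with
  | nil => simp [word, signSum]
  | cons t s ih =>
    have h₁ : word (z • a) (t :: s) = letter (z • a) t * word (z • a) s := by simp [word]
    have h₂ : word a (t :: s) = letter a t * word a s := by simp [word]
    have h₃ : signSum (t :: s) = t + signSum s := by simp [signSum]
    have h₄ : letter (z • a) t = z ^ (t : ℤ) • letter a t := by
      rcases Int.units_eq_one_or t with rfl | rfl
      · simp [letter]
      · simp [letter, star_smul, Complex.inv_eq_conj hz]
    rw [h₁, h₂, h₃, h₄, ih, smul_mul_smul_comm, zpow_add₀ hz0]

/-- `a` and all its rotations have the same distribution exactly when `φ` vanishes on words of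
nonzero degree. -/
lemma sameDistribution_smul_iff [StarModule ℂ A] :
    (∀ z : ℂ, ‖z‖ = 1 → SameDistribution φ a φ (z • a)) ↔
      ∀ h ≠ 0, ∀ x ∈ wordSpan a Set.univ h, φ x = 0 := by
  constructor
  · intro H h hh x hx
    refine (Submodule.span_le (p := LinearMap.ker φ)).2 ?_ hx
    rintro _ ⟨s, rfl, -, rfl⟩
    -- The rotation `z` is chosen so that `z ^ signSum s = -1`.
    set z : ℂ := Complex.exp ((Real.pi / signSum s : ℝ) * Complex.I) with hz
    have hz1 : ‖z‖ = 1 := Complex.norm_exp_ofReal_mul_I _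
    have hpow : z ^ signSum s = -1 := by
      rw [hz, ← Complex.exp_int_mul, ← Complex.exp_pi_mul_I]
      congr 1
      have : (signSum s : ℂ) ≠ 0 := by exact_mod_cast hh
      push_cast
      field_simp
    have hne : s ≠ [] := by rintro rfl; simp [signSum] at hh
    have h₁ := H z hz1 s hne
    rw [word_smul hz1, hpow, neg_one_smul, map_neg] at h₁
    exact self_eq_neg.1 h₁
  · intro H z hz s _
    rw [word_smul hz, map_smul]
    by_cases hs : signSum s = 0
    · simp [hs]
    · have := H _ hs (word a s) (Submodule.subset_span ⟨s, rfl, fun _ => trivial, rfl⟩)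
      simp [this]

/-! ### From `R`-diagonality to freeness -/

/-- The span of the products along nonempty paths from `i` to `j`. -/
def pathSpan (φ : A →ₗ[ℂ] ℂ) (a : A) (i j : Fin 2) : Submodule ℂ A :=
  Submodule.span ℂ {x | ∃ n h, AltPath φ a freeStep (n + 1) h i j x}

lemma mul_mem_pathSpan {i j k : Fin 2} {x y : A} (hx : x ∈ pathSpan φ a i j)
    (hy : y ∈ pathSpan φ a j k) : x * y ∈ pathSpan φ a i k := by
  have := Submodule.mul_mem_mul hx hy
  rw [pathSpan, pathSpan, Submodule.span_mul_span] at this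
  refine Submodule.span_mono ?_ this
  rintro _ ⟨_, ⟨n, h, p⟩, _, ⟨n', h', q⟩, rfl⟩
  exact ⟨n + 1 + n', _, p.mul_free q⟩

lemma IsRDiagonal.map_pathSpan (H : IsRDiagonal φ a) {i j : Fin 2} {x : A}
    (hx : x ∈ pathSpan φ a i j) : φ x = 0 := by
  refine (Submodule.span_le (p := LinearMap.ker φ)).2 ?_ hx
  rintro x ⟨n, h, p⟩
  exact isRDiagonal_iff_altPath.1 H n h i j x p

lemma IsRDiagonal.map_wordSpan (H : IsRDiagonal φ a) (h1 : φ 1 = 1) {h : ℤ} (hh : h ≠ 0) {x : A}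
    (hx : x ∈ wordSpan a Set.univ h) : φ x = 0 := by
  refine (Submodule.span_le (p := LinearMap.ker φ)).2 ?_ (wordSpan_le_span_altPath h1 h hx)
  rintro x ⟨n, i, j, p⟩
  cases n with
  | zero => cases p; exact absurd rfl hh
  | succ n => exact isRDiagonal_iff_altPath.1 H n h i j x p.free

lemma mem_adjoin_mul_star_iff {x : A} :
    x ∈ Algebra.adjoin ℂ {a * star a} ↔
      x ∈ Submodule.span ℂ (Set.range fun k : ℕ => (a * star a) ^ k) := by
  rw [← Subalgebra.mem_toSubmodule, Algebra.adjoin_eq_span, ← Submonoid.powers_eq_closure]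
  rfl

/-- The centered elements of the two algebras are combinations of products along paths from `2`
to `1` and from `1` to `2` respectively. -/
lemma IsRDiagonal.mem_pathSpan (H : IsRDiagonal φ a) (h1 : φ 1 = 1) (e : Fin 2) {x : A}
    (hx : x ∈ Algebra.adjoin ℂ ((![{a * star a}, (balancedSpan a : Set A)] : Fin 2 → Set A) e))
    (hφx : φ x = 0) : x ∈ pathSpan φ a (e + 1) e := by
  fin_cases e
  · have hx' : x ∈ altSpace φ a 1 0 := ⟨mem_adjoin_mul_star_iff.1 (by simpa using hx), hφx⟩
    exact Submodule.subset_span ⟨0, _, AltPath.single hx' trivial⟩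
  · have hx₁ : x ∈ wordSpan a (Set.Iic 0) 0 := by
      rw [← adjoin_balancedSpan_eq_wordSpan]; simpa using hx
    have hx₂ : x ∈ Submodule.span ℂ {1} ⊔ pathSpan φ a 0 1 := by
      refine Submodule.span_le.2 ?_ (wordSpan_le_span_altPath h1 0 hx₁)
      rintro x ⟨n, i, j, p⟩
      cases n with
      | zero =>
        rw [p.zero.2]
        exact Submodule.mem_sup_left (Submodule.mem_span_singleton_self _)
      | succ n =>
        obtain ⟨rfl, hj⟩ := p.endpoints_of_letter
        obtain rfl := hj rfl
        exact Submodule.mem_sup_right (Submodule.subset_span ⟨n, _, p.free⟩)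
    obtain ⟨u, hu, v, hv, rfl⟩ := Submodule.mem_sup.1 hx₂
    obtain ⟨c, rfl⟩ := Submodule.mem_span_singleton.1 hu
    have hc : c = 0 := by simpa [h1, H.map_pathSpan hv] using hφx
    simpa [hc] using hv

lemma IsRDiagonal.isFree (H : IsRDiagonal φ a) (h1 : φ 1 = 1) :
    IsFree φ ![{a * star a}, (balancedSpan a : Set A)] := by
  intro l hl hchain hmem hcen
  suffices key : ∀ (l : List (Fin 2 × A)) (p : Fin 2 × A),
      ((p :: l).map Prod.fst).IsChain (fun i j => i ≠ j) →
      (∀ q ∈ p :: l, q.2 ∈ pathSpan φ a (q.1 + 1) q.1) →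
      ∃ j, ((p :: l).map Prod.snd).prod ∈ pathSpan φ a (p.1 + 1) j by
    obtain ⟨p, l, rfl⟩ := List.exists_cons_of_ne_nil hl
    obtain ⟨j, hj⟩ := key l p hchain fun q hq => H.mem_pathSpan h1 q.1 (hmem q hq) (hcen q hq)
    exact H.map_pathSpan hj
  intro l
  induction l with
  | nil => intro p _ hp; exact ⟨p.1, by simpa using hp⟩
  | cons q l ih =>
    intro p hchain hp
    rw [List.map_cons, List.map_cons, List.isChain_cons_cons] at hchain
    obtain ⟨j, hj⟩ := ih q (by simpa using hchain.2) fun r hr => hp r (List.mem_cons_of_mem _ hr)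
    have hpq : q.1 + 1 = p.1 := by
      have hne : ∀ i k : Fin 2, i ≠ k → k + 1 = i := by decide
      exact hne _ _ hchain.1
    refine ⟨j, ?_⟩
    rw [List.map_cons, List.prod_cons]
    rw [hpq] at hj
    exact mul_mem_pathSpan (hp p (by simp)) hj

/-! ### From freeness to `R`-diagonality -/

/-- A path can be cut at a point of maximal height `m`: after the cut the path stays below its
starting height, and the part before the cut can be appended to any path of nonpositive height
for which the resulting final height is nonpositive. -/
lemma AltPath.exists_split_top {n h i j x} (p : AltPath φ a freeStep n h i j x) :
    ∃ n₁ n₂ m k q r, n = n₁ + n₂ ∧ x = q * r ∧ AltPath φ a topStep n₂ (h - m) k j r ∧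
      ∀ n' h' i' y, AltPath φ a topStep n' h' i' i y → h' + m ≤ 0 →
        AltPath φ a topStep (n' + n₁) (h' + m) i' k (y * q) := by
  induction p with
  | nil i => exact ⟨0, 0, 0, i, 1, 1, rfl, by simp, .nil i, fun n' h' i' y p _ => by simpa using p⟩
  | @snoc n h i j k' x y p hy _ ih =>
    obtain ⟨n₁, n₂, m, k, q, r, rfl, rfl, hr, hq⟩ := ih
    by_cases hm : h - m + stepDeg j k' ≤ 0
    · refine ⟨n₁, n₂ + 1, m, k, q, r * y, by omega, mul_assoc _ _ _, ?_, hq⟩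
      rw [add_sub_right_comm]
      exact hr.snoc hy hm
    · refine ⟨n₁ + n₂ + 1, 0, h + stepDeg j k', k', q * r * y, 1, rfl, by simp,
        by simpa using AltPath.nil k', fun n' h' i' z pz hz => ?_⟩
      have h₁ := (hq n' h' i' z pz (by omega)).mul hr (C := topStep) fun h'' _ _ hc => by
        simp only [topStep] at *; omega
      have h₂ := h₁.snoc hy (by simp only [topStep]; omega)
      convert h₂ using 1
      · omega
      · omega
      · simp only [mul_assoc]

/-- A path whose heights between factors stay nonpositive, parsed from the left: the factors of
type `aa⋆ ⋯` at height `0` cut it into products of degree `0` belonging to `K_a`. The list `l`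
holds the completed part, and `y` is the product of the factors after the last cut. The
completed products along shorter paths are centered by hypothesis. -/
lemma AltPath.exists_parse {N : ℕ}
    (IH : ∀ n h i j x, n < N → AltPath φ a freeStep (n + 1) h i j x → φ x = 0)
    {n h i j x} (p : AltPath φ a topStep n h i j x) (hn : n ≤ N + 1) :
    ∃ (l : List (Fin 2 × A)) (m : ℕ) (i' : Fin 2) (y : A),
      AltPath φ a (letterStep (Set.Iic 0)) m h i' j y ∧ x = (l.map Prod.snd).prod * y ∧
      (l.map Prod.fst).IsChain (fun i j => i ≠ j) ∧
      (∀ q ∈ l, q.2 ∈ Algebra.adjoin ℂ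
        ((![{a * star a}, (balancedSpan a : Set A)] : Fin 2 → Set A) q.1) ∧ φ q.2 = 0) ∧
      (l = [] ∧ i' = i ∧ m = n ∨ m < n ∧ i' = 0 ∧ (l.map Prod.fst).getLast? = some 0) := by
  induction p with
  | nil i => exact ⟨[], 0, i, 1, .nil i, by simp, by simp, by simp, Or.inl ⟨rfl, rfl, rfl⟩⟩
  | @snoc n h i j k x u p hu hc ih =>
    obtain ⟨l, m, i', y, hy, rfl, hchain, hmem, hlast⟩ := ih (by omega)
    by_cases hstep : letterStep (Set.Iic 0) h j k
    · refine ⟨l, m + 1, i', y * u, hy.snoc hu hstep, mul_assoc _ _ _, hchain, hmem, ?_⟩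
      rcases hlast with ⟨h₁, h₂, h₃⟩ | ⟨h₁, h₂, h₃⟩
      · exact Or.inl ⟨h₁, h₂, by omega⟩
      · exact Or.inr ⟨by omega, h₂, h₃⟩
    -- The only step allowed by `topStep` but not by `letterStep` is `P₂₁` at height `0`: a cut.
    have hh := p.height_nonpos_of_top
    obtain ⟨rfl, rfl, rfl⟩ : h = 0 ∧ j = 1 ∧ k = 0 := by
      simp only [letterStep, Set.mem_Iic, topStep, stepDeg] at *
      omega
    have huA : u ∈ Algebra.adjoin ℂ
        ((![{a * star a}, (balancedSpan a : Set A)] : Fin 2 → Set A) 0) := by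
      simpa using mem_adjoin_mul_star_iff.2 hu.1
    have huc : φ u = 0 := hu.2
    have hnil : AltPath φ a (letterStep (Set.Iic 0)) 0 (0 + stepDeg 1 0) 0 0 1 := by
      simpa [stepDeg] using AltPath.nil 0
    cases m with
    | zero =>
      obtain ⟨rfl, rfl⟩ := hy.zero
      rcases hlast with ⟨rfl, h₂, h₃⟩ | ⟨h₁, h₂, h₃⟩
      · exact ⟨[(0, u)], 0, 0, 1, hnil, by simp, by simp, by simpa using ⟨by simpa using huA, huc⟩,
          Or.inr ⟨by omega, rfl, by simp⟩⟩
      · exact absurd h₂ (by decide)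
    | succ m =>
      have hyA : y ∈ Algebra.adjoin ℂ
          ((![{a * star a}, (balancedSpan a : Set A)] : Fin 2 → Set A) 1) :=
        hy.mem_adjoin_balancedSpan
      have hyc : φ y = 0 := IH m _ _ _ y (by omega) hy.free
      refine ⟨l ++ [(1, y), (0, u)], 0, 0, 1, hnil, by simp [mul_assoc], ?_, ?_,
        Or.inr ⟨by omega, rfl, by simp⟩⟩
      · rw [List.map_append, List.isChain_append]
        refine ⟨hchain, by simp, fun s hs t ht => ?_⟩
        rcases hlast with ⟨rfl, -, -⟩ | ⟨-, -, h₃⟩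
        · simp at hs
        · rw [h₃] at hs
          simp at hs ht
          subst hs ht
          decide
      · intro q hq
        simp only [List.mem_append, List.mem_cons, List.not_mem_nil, or_false] at hq
        rcases hq with hq | rfl | rfl
        exacts [hmem q hq, ⟨hyA, hyc⟩, ⟨huA, huc⟩]

/-- Freeness kills closed paths of degree `0` whose heights between factors stay nonpositive. -/
lemma AltPath.map_eq_zero_of_top (hfree : IsFree φ ![{a * star a}, (balancedSpan a : Set A)])
    {N : ℕ} (IH : ∀ n h i j x, n < N → AltPath φ a freeStep (n + 1) h i j x → φ x = 0)
    {i x} (p : AltPath φ a topStep (N + 1) 0 i i x) : φ x = 0 := by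
  obtain ⟨l, m, i', y, hy, rfl, hchain, hmem, hlast⟩ := p.exists_parse IH le_rfl
  cases m with
  | zero =>
    obtain ⟨-, rfl⟩ := hy.zero
    rcases hlast with ⟨-, -, h₃⟩ | ⟨-, -, h₃⟩
    · omega
    · rw [mul_one]
      exact hfree l (by rintro rfl; simp at h₃) hchain (fun q hq => (hmem q hq).1)
        fun q hq => (hmem q hq).2
  | succ m =>
    obtain ⟨h₀, h₁⟩ := hy.endpoints_of_letter
    have h₁ := h₁ rfl
    rcases hlast with ⟨-, h₂, -⟩ | ⟨hm, -, h₃⟩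
    · subst h₁ h₀
      exact absurd h₂ (by decide)
    · have hyA : y ∈ Algebra.adjoin ℂ
          ((![{a * star a}, (balancedSpan a : Set A)] : Fin 2 → Set A) 1) :=
        hy.mem_adjoin_balancedSpan
      have hyc : φ y = 0 := IH m _ _ _ y (by omega) hy.free
      have hmem' : ∀ q ∈ l ++ [((1 : Fin 2), y)], q.2 ∈ Algebra.adjoin ℂ
          ((![{a * star a}, (balancedSpan a : Set A)] : Fin 2 → Set A) q.1) ∧ φ q.2 = 0 := by
        intro q hq
        simp only [List.mem_append, List.mem_cons, List.not_mem_nil, or_false] at hq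
        rcases hq with hq | rfl
        exacts [hmem q hq, ⟨hyA, hyc⟩]
      have := hfree (l ++ [(1, y)]) (by simp) ?_ (fun q hq => (hmem' q hq).1)
        fun q hq => (hmem' q hq).2
      · simpa using this
      · rw [List.map_append, List.isChain_append]
        refine ⟨hchain, by simp, fun s hs t ht => ?_⟩
        rw [h₃] at hs
        simp at hs ht
        subst hs ht
        decide

/-- Rotation invariance (in the form `hdeg`) and freeness kill all nonempty paths, by induction on
the number of factors. -/
lemma AltPath.map_eq_zero (h1 : φ 1 = 1) (htr : ∀ x y : A, φ (x * y) = φ (y * x))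
    (hdeg : ∀ h ≠ 0, ∀ x ∈ wordSpan a Set.univ h, φ x = 0)
    (hfree : IsFree φ ![{a * star a}, (balancedSpan a : Set A)])
    {n h i j x} (p : AltPath φ a freeStep (n + 1) h i j x) : φ x = 0 := by
  induction n using Nat.strong_induction_on generalizing h i j x with
  | _ n ih =>
  by_cases hij : i = j
  · subst hij
    by_cases hh : h = 0
    · subst hh
      obtain ⟨n₁, n₂, m, k, q, r, hn, rfl, hr, hq⟩ := p.exists_split_top
      -- Swapping the two parts rotates the path so that it starts at its maximal height.
      have hrot := hq _ _ _ _ hr (by omega)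
      rw [add_comm n₂, ← hn, sub_add_cancel] at hrot
      rw [htr]
      exact hrot.map_eq_zero_of_top hfree fun n' _ _ _ _ hlt p' => ih n' hlt p'
    · exact hdeg h hh x ((p.mono (D := letterStep Set.univ) fun _ _ _ _ => trivial).mem_wordSpan
        isLowerSet_univ trivial)
  -- The end points differ: by traciality the last factor can be merged with the first one.
  · obtain ⟨k, y, h', x', hy, p', rfl⟩ := p.exists_cons
    cases p' with
    | nil => rw [mul_one]; exact (mem_altSpace.1 hy).2 hij
    | @snoc n h'' _ l _ x'' w p'' hw _ =>
      obtain ⟨u, hu, c, hwy, hlc⟩ := altSpace_mul h1 (Ne.symm hij) hw hy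
      rw [htr, mul_assoc, hwy, mul_add, map_add, mul_smul_comm, mul_one, map_smul,
        ih n (by omega) (p''.snoc hu trivial), zero_add]
      by_cases hlk : l = k
      · simp [hlc hlk]
      · cases n with
        | zero => exact absurd p''.zero.1.symm hlk
        | succ n => simp [ih n (by omega) p'']

end

end FreeProb

theorem mainTheorem6 {A : Type*} [Ring A] [StarRing A] [Algebra ℂ A] [StarModule ℂ A]
    (φ : A →ₗ[ℂ] ℂ) (hφ : FreeProb.IsFaithfulTracialState φ) (a : A) :
    FreeProb.IsRDiagonal φ a ↔
      (∀ z : ℂ, ‖z‖ = 1 → FreeProb.SameDistribution φ a φ (z • a)) ∧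
      FreeProb.IsFree φ ![{a * star a}, (FreeProb.balancedSpan a : Set A)] := by
  rw [FreeProb.sameDistribution_smul_iff]
  constructor
  · intro H
    exact ⟨fun h hh x hx => H.map_wordSpan hφ.map_one hh hx, H.isFree hφ.map_one⟩
  · rintro ⟨hdeg, hfree⟩
    exact FreeProb.isRDiagonal_iff_altPath.2 fun n h i j x p =>
      p.map_eq_zero hφ.map_one hφ.tracial hdeg hfree
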